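/- Let $K=\mathbb R$ or $\mathbb C$. For $K$-vector spaces $E,F$ let $F[E]_m$ be the space of maps $f:E\to F$ of the form $f(x)=u(x,\dots,x)$ with $u:E^m\to F$ an $m$-linear map (we say that $u$ determines $f$), and let $F[[E]]=\prod_{m\ge 0}F[E]_m$, $S(X)=X[[X]]$. For $\xi\in X[X]_r$ and $f\in F[X]_m$ determined by $u$, let $(\xi f)(x)=\sum_{i=1}^m u(x,\dots,\xi(x),\dots,x)$, with $\xi(x)$ in the $i$-th place; this does not depend on $u$ and lies in $F[X]_{r+m-1}$ (it is $0$ if $r=m=0$). For $\xi=(\xi_r)\in S(X)$ and $f=(f_m)\in F[[X]]$ let $\xi f=(g_s)_{s\ge 0}$ with $g_s=\sum_{r+m-1=s}\xi_r f_m$. With the bracket $[\xi,\eta]=\xi\eta-\eta\xi$, $S(X)$ is a Lie algebra over $K$. A formal action of a Lie algebra $A$ over $X$ is a Lie algebra homomorphism $A\to S(X)$. Let $A$ be a complete normable Lie algebra over $K$ (a Banach space with a continuous Lie bracket), $X$ a Banach space over $K$, and $U$ an open neighbourhood of $0$ in $X$. Let $a\mapsto D_a$ be an analytic law of right infinitesimal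 operation of $A$ in $U$, that is, a map which associates to each $a\in A$ a vector field $D_a$ on $U$ such that $(a,x)\mapsto D_a(x)$ is an analytic morphism of vector bundles from the trivial bundle $A\times U$ to the tangent bundle of $U$ (equivalently, with $TU=U\times X$, $D_a(x)=\Phi(x)(a)$ for an analytic map $\Phi:U\to\mathcal L(A,X)$ into the continuous linear maps), and such that $[D_a,D_b]=D_{[a,b]}$ for all $a,b\in A$, where $[V,W](x)=dW_x(V(x))-dV_x(W(x))$. Let $h:U\to X$ be the inclusion and let $D_a(h):U\to X$, $x\mapsto dh_x(D_a(x))$, be the derivative of $h$ along $D_a$. Then, for each $a\in A$, the map $D_a(h)$ is analytic on $U$ and it is represented near $0$ by a unique element $\delta_a$ of $S(X)$, the components of which are continuous and the sum of which converges to $D_a(h)$ near $0$ (its power series at $0$). The map $\delta:A\to S(X)$, $a\mapsto\delta_a$, is a formal action of $A$ over $X$. -/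

import Mathlib

noncomputable section

namespace FormalLie

section Algebraic

variable {K E F X : Type*} [Field K] [AddCommGroup E] [Module K E] [AddCommGroup F] [Module K F]
  [AddCommGroup X] [Module K X]

/-- `Determines u f`: the map `f` is `x ↦ u (x, …, x)`. -/
def Determines {m : ℕ} (u : MultilinearMap K (fun _ : Fin m => E) F) (f : E → F) : Prop :=
  ∀ x, f x = u (fun _ => x)

variable (K E F) in
/-- `F[E]_m`: the space of homogeneous polynomials of degree `m`, with variables in `E` and
coefficients in `F`. No continuity is involved. -/
def homogPoly (m : ℕ) : Submodule K (E → F) where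
  carrier := {f | ∃ u : MultilinearMap K (fun _ : Fin m => E) F, Determines u f}
  zero_mem' := ⟨0, fun _ => rfl⟩
  add_mem' := by
    rintro f g ⟨u, hu⟩ ⟨v, hv⟩
    exact ⟨u + v, fun x => by simp [hu x, hv x]⟩
  smul_mem' := by
    rintro c f ⟨u, hu⟩
    exact ⟨c • u, fun x => by simp [hu x]⟩

variable (K E F) in
/-- `F[[E]] = ∏ₘ F[E]_m`: formal series with variables in `E` and coefficients in `F`. -/
def FormalSeries : Type _ := ∀ m : ℕ, homogPoly K E F m

instance : AddCommGroup (FormalSeries K E F) :=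
  inferInstanceAs (AddCommGroup (∀ m : ℕ, homogPoly K E F m))

instance : Module K (FormalSeries K E F) :=
  inferInstanceAs (Module K (∀ m : ℕ, homogPoly K E F m))

variable (K X) in
/-- `S(X) = X[[X]]`. -/
abbrev S : Type _ := FormalSeries K X X

/-- For `f` in `F[E]_m` determined by `u`, this is the sum of all terms `u (x₁, …, xₘ)` where exactly
one of the `xᵢ` is replaced by `y`, the others being equal to `x`. See `polyDiff_eq` for the
independence of the choice of `u`. -/
def polyDiff {m : ℕ} (f : homogPoly K E F m) (x y : E) : F :=
  ∑ i : Fin m, f.2.choose (Function.update (fun _ => x) i y)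

/-! ### The derivative does not depend on the choice of the multilinear map -/

theorem linearDeriv_eq_zero [CharZero K] {m : ℕ} (u : MultilinearMap K (fun _ : Fin m => E) F)
    (hu : ∀ x, u (fun _ => x) = 0) (x y : E) :
    ∑ i : Fin m, u (Function.update (fun _ => x) i y) = 0 := by
  classical
  have key : ∀ t : K, t • (∑ i : Fin m, u (Function.update (fun _ => x) i y)) +
      ∑ s : Finset (Fin m) with 2 ≤ s.card,
        t ^ s.card • u (s.piecewise (fun _ => y) (fun _ => x)) = 0 := by
    intro t
    have h := u.map_add_eq_map_add_linearDeriv_add (fun _ => x) (t • fun _ => y)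
    have h1 : ((fun _ => x) + t • fun _ => y : Fin m → E) = fun _ => x + t • y := rfl
    rw [h1, hu, hu, zero_add, map_smul, MultilinearMap.linearDeriv_apply] at h
    rw [h]
    congr 1
    refine Finset.sum_congr rfl fun s _ => ?_
    have := u.map_piecewise_smul (fun _ => t) (s.piecewise (fun _ => y) (fun _ => x)) s
    simp only [Finset.prod_const] at this
    rw [← this]
    congr 1
    ext i
    by_cases hi : i ∈ s <;> simp [hi]
  rw [← Module.forall_dual_apply_eq_zero_iff K]
  intro φ
  set P : Polynomial K :=
    Polynomial.X * Polynomial.C (φ (∑ i : Fin m, u (Function.update (fun _ => x) i y))) +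
      ∑ s : Finset (Fin m) with 2 ≤ s.card,
        Polynomial.X ^ s.card * Polynomial.C (φ (u (s.piecewise (fun _ => y) (fun _ => x)))) with hP
  have hP0 : P = 0 := by
    refine Polynomial.funext fun t => ?_
    have := congrArg φ (key t)
    rw [map_add, map_smul, map_zero] at this
    erw [map_sum φ (fun s : Finset (Fin m) => t ^ s.card • u (s.piecewise (fun _ => y) fun _ => x))]
      at this
    simp only [map_smul, smul_eq_mul] at this
    simp only [hP, Polynomial.eval_add, Polynomial.eval_mul, Polynomial.eval_X, Polynomial.eval_C,
      Polynomial.eval_finsetSum, Polynomial.eval_pow, Polynomial.eval_zero]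
    exact this
  have h1 := congrArg (fun Q => Polynomial.coeff Q 1) hP0
  simp only [hP, Polynomial.coeff_add, Polynomial.finsetSum_coeff, Polynomial.coeff_mul_C,
    Polynomial.coeff_X_one, one_mul, Polynomial.coeff_zero, Polynomial.coeff_X_pow] at h1
  rwa [Finset.sum_eq_zero (s := Finset.univ.filter _), add_zero] at h1
  intro s hs
  have : 1 ≠ s.card := by
    have := (Finset.mem_filter.1 hs).2
    omega
  simp [this]

theorem polyDiff_eq [CharZero K] {m : ℕ} (f : homogPoly K E F m)
    (u : MultilinearMap K (fun _ : Fin m => E) F) (hu : Determines u f) (x y : E) :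
    polyDiff f x y = ∑ i : Fin m, u (Function.update (fun _ => x) i y) := by
  have h := linearDeriv_eq_zero (f.2.choose - u)
    (fun x => by
      have h1 := f.2.choose_spec x
      have h2 := hu x
      rw [sub_apply, ← h1, ← h2, sub_self]) x y
  simp only [sub_apply, Finset.sum_sub_distrib] at h
  exact sub_eq_zero.1 h

theorem polyDiff_map_add {m : ℕ} (f : homogPoly K E F m) (x y z : E) :
    polyDiff f x (y + z) = polyDiff f x y + polyDiff f x z := by
  simp [polyDiff, Finset.sum_add_distrib]

theorem polyDiff_map_smul {m : ℕ} (f : homogPoly K E F m) (x y : E) (c : K) :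
    polyDiff f x (c • y) = c • polyDiff f x y := by
  simp [polyDiff, Finset.smul_sum]

theorem polyDiff_map_sum {m : ℕ} {ι : Type*} (f : homogPoly K E F m) (x : E) (t : Finset ι)
    (y : ι → E) : polyDiff f x (∑ i ∈ t, y i) = ∑ i ∈ t, polyDiff f x (y i) :=
  map_sum (⟨⟨polyDiff f x, by simpa using polyDiff_map_smul f x 0 0⟩,
    polyDiff_map_add f x⟩ : E →+ F) y t

theorem polyDiff_degree_zero (f : homogPoly K E F 0) (x y : E) : polyDiff f x y = 0 := by
  simp [polyDiff]

theorem polyDiff_add [CharZero K] {m : ℕ} (f g : homogPoly K E F m) (x y : E) :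
    polyDiff (f + g) x y = polyDiff f x y + polyDiff g x y := by
  rw [polyDiff_eq (f + g) (f.2.choose + g.2.choose)
    (fun x => by
      have h1 := f.2.choose_spec x
      have h2 := g.2.choose_spec x
      simp only [Submodule.coe_add, Pi.add_apply, add_apply]
      rw [← h1, ← h2])]
  simp [polyDiff, Finset.sum_add_distrib]

theorem polyDiff_smul [CharZero K] {m : ℕ} (c : K) (f : homogPoly K E F m) (x y : E) :
    polyDiff (c • f) x y = c • polyDiff f x y := by
  rw [polyDiff_eq (c • f) (c • f.2.choose)
    (fun x => by
      have h1 := f.2.choose_spec x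
      simp only [Submodule.coe_smul, Pi.smul_apply, smul_apply]
      rw [← h1])]
  simp [polyDiff, Finset.smul_sum]

theorem polyDiff_sum [CharZero K] {m : ℕ} {ι : Type*} (t : Finset ι) (f : ι → homogPoly K E F m)
    (x y : E) : polyDiff (∑ i ∈ t, f i) x y = ∑ i ∈ t, polyDiff (f i) x y :=
  map_sum (⟨⟨fun f => polyDiff f x y, by simpa using polyDiff_smul (0 : K) (0 : homogPoly K E F m) x y⟩,
    fun f g => polyDiff_add f g x y⟩ : homogPoly K E F m →+ F) f t

/-! ### Derivation relative to a formal series -/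

/-- The multilinear map `(z, z') ↦ u (z', …, v z, …, z')`, with `v z` in the `i`-th place. -/
def plug {r k : ℕ} (u : MultilinearMap K (fun _ : Fin (k + 1) => X) F)
    (v : MultilinearMap K (fun _ : Fin r => X) X) (i : Fin (k + 1)) :
    MultilinearMap K (fun _ : Fin (r + k) => X) F :=
  (MultilinearMap.uncurrySum (N := fun _ : Fin r ⊕ Fin k => X)
    ((MultilinearMap.curryMid (M := fun _ => X) i u).compMultilinearMap v)).domDomCongr finSumFinEquiv

theorem plug_apply {r k : ℕ} (u : MultilinearMap K (fun _ : Fin (k + 1) => X) F)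
    (v : MultilinearMap K (fun _ : Fin r => X) X) (i : Fin (k + 1)) (z : Fin (r + k) → X) :
    plug u v i z = u (i.insertNth (v fun j => z (Fin.castAdd k j)) fun j => z (Fin.natAdd r j)) := by
  simp [plug]

theorem insertNth_const {Y : Type*} {k : ℕ} (i : Fin (k + 1)) (x y : Y) :
    (i.insertNth y fun _ => x : Fin (k + 1) → Y) = Function.update (fun _ => x) i y := by
  ext j
  cases j using Fin.succAboveCases i <;> simp

theorem plug_determines {r k : ℕ} (u : MultilinearMap K (fun _ : Fin (k + 1) => X) F)
    (v : MultilinearMap K (fun _ : Fin r => X) X) (x : X) :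
    (∑ i, plug u v i) (fun _ => x) =
      ∑ i, u (Function.update (fun _ => x) i (v fun _ => x)) := by
  simp [plug_apply, insertNth_const]

theorem polyDiff_mem {r m s : ℕ} (h : r + m = s + 1) (ξ : homogPoly K X X r)
    (f : homogPoly K X F m) :
    (fun x => polyDiff f x ((ξ : X → X) x)) ∈ homogPoly K X F s := by
  obtain _ | k := m
  · convert (homogPoly K X F s).zero_mem using 1
    ext x
    exact polyDiff_degree_zero f x _
  · obtain rfl : s = r + k := by omega
    refine ⟨∑ i, plug f.2.choose ξ.2.choose i, fun x => ?_⟩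
    have h1 := ξ.2.choose_spec x
    rw [plug_determines, ← h1]
    rfl

/-- The product `ξ f` of `ξ` in `X[X]_r` and `f` in `F[X]_m`: the homogeneous polynomial
`x ↦ ũ ((ξ x, x); (1, m - 1))` of degree `s = r + m - 1`, where `u` determines `f`. -/
def polyDeriv {r m s : ℕ} (h : r + m = s + 1) (ξ : homogPoly K X X r) (f : homogPoly K X F m) :
    homogPoly K X F s :=
  ⟨fun x => polyDiff f x ((ξ : X → X) x), polyDiff_mem h ξ f⟩

/-- The derivative `ξ f` of `f` relative to the formal series `ξ`: its component of degree `s` is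
the sum of the `ξ_r f_m` with `r + m - 1 = s`. -/
def FormalSeries.deriv (ξ : S K X) (f : FormalSeries K X F) : FormalSeries K X F := fun s =>
  ∑ p ∈ (Finset.HasAntidiagonal.antidiagonal (s + 1)).attach,
    polyDeriv (Finset.HasAntidiagonal.mem_antidiagonal.1 p.2) (ξ p.1.1) (f p.1.2)

theorem deriv_apply (ξ : S K X) (f : FormalSeries K X F) (s : ℕ) (x : X) :
    (ξ.deriv f s : X → F) x =
      ∑ p ∈ Finset.HasAntidiagonal.antidiagonal (s + 1), polyDiff (f p.2) x ((ξ p.1 : X → X) x) := by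
  rw [← Finset.sum_attach (Finset.HasAntidiagonal.antidiagonal (s + 1))]
  simp [FormalSeries.deriv, polyDeriv]

@[ext]
theorem FormalSeries.ext {f g : FormalSeries K E F}
    (h : ∀ s x, (f s : E → F) x = (g s : E → F) x) : f = g :=
  funext fun s => Subtype.ext (funext fun x => h s x)

@[simp] theorem coe_add_apply (f g : FormalSeries K E F) (s : ℕ) (x : E) :
    ((f + g) s : E → F) x = (f s : E → F) x + (g s : E → F) x := rfl

@[simp] theorem coe_sub_apply (f g : FormalSeries K E F) (s : ℕ) (x : E) :
    ((f - g) s : E → F) x = (f s : E → F) x - (g s : E → F) x := rfl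

@[simp] theorem coe_smul_apply (c : K) (f : FormalSeries K E F) (s : ℕ) (x : E) :
    ((c • f) s : E → F) x = c • (f s : E → F) x := rfl

theorem add_deriv (ξ η : S K X) (f : FormalSeries K X F) :
    (ξ + η).deriv f = ξ.deriv f + η.deriv f := by
  ext s x
  simp only [deriv_apply, coe_add_apply, polyDiff_map_add, Finset.sum_add_distrib]

theorem smul_deriv (c : K) (ξ : S K X) (f : FormalSeries K X F) :
    (c • ξ).deriv f = c • ξ.deriv f := by
  ext s x
  simp only [deriv_apply, coe_smul_apply, polyDiff_map_smul, Finset.smul_sum]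

theorem deriv_add [CharZero K] (ξ : S K X) (f g : FormalSeries K X F) :
    ξ.deriv (f + g) = ξ.deriv f + ξ.deriv g := by
  ext s x
  simp only [deriv_apply, coe_add_apply]
  rw [← Finset.sum_add_distrib]
  exact Finset.sum_congr rfl fun p _ => polyDiff_add (f p.2) (g p.2) x _

theorem deriv_smul [CharZero K] (c : K) (ξ : S K X) (f : FormalSeries K X F) :
    ξ.deriv (c • f) = c • ξ.deriv f := by
  ext s x
  simp only [deriv_apply, coe_smul_apply, Finset.smul_sum]
  exact Finset.sum_congr rfl fun p _ => polyDiff_smul c (f p.2) x _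

/-! ### The Lie algebra `S(X)` -/

/-- The second order analogue of `polyDiff`. -/
def polyDiff₂ {m : ℕ} (f : homogPoly K E F m) (x a b : E) : F :=
  ∑ i : Fin m, ∑ j : Fin m, if j = i then 0 else
    f.2.choose (Function.update (Function.update (fun _ => x) i a) j b)

theorem polyDiff₂_comm {m : ℕ} (f : homogPoly K E F m) (x a b : E) :
    polyDiff₂ f x a b = polyDiff₂ f x b a := by
  unfold polyDiff₂
  rw [Finset.sum_comm]
  refine Finset.sum_congr rfl fun i _ => Finset.sum_congr rfl fun j _ => ?_
  by_cases h : j = i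
  · simp [h]
  · rw [if_neg h, if_neg (Ne.symm h), Function.update_comm h]

theorem polyDiff_polyDeriv [CharZero K] {r m s : ℕ} (h : r + m = s + 1) (ξ : homogPoly K X X r)
    (f : homogPoly K X F m) (x y : X) :
    polyDiff (polyDeriv h ξ f) x y =
      polyDiff f x (polyDiff ξ x y) + polyDiff₂ f x ((ξ : X → X) x) y := by
  obtain _ | k := m
  · have h0 : polyDeriv h ξ f = 0 :=
      Subtype.ext (funext fun x => polyDiff_degree_zero f x ((ξ : X → X) x))
    rw [h0, polyDiff_degree_zero]
    have := polyDiff_smul (0 : K) (0 : homogPoly K X F s) x y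
    simpa [polyDiff₂] using this
  · obtain rfl : s = r + k := by omega
    rw [polyDiff_eq _ (∑ i, plug f.2.choose ξ.2.choose i) (fun x => by
      have h1 := ξ.2.choose_spec x
      rw [plug_determines, ← h1]
      rfl)]
    have hξ : (ξ : X → X) x = ξ.2.choose fun _ => x := ξ.2.choose_spec x
    simp only [sum_apply, plug_apply]
    rw [Fin.sum_univ_add, Finset.sum_comm (s := Finset.univ (α := Fin r)),
      Finset.sum_comm (s := Finset.univ (α := Fin k))]
    congr 1
    · conv_rhs => rw [polyDiff]
      refine Finset.sum_congr rfl fun i _ => ?_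
      have e : ∀ j : Fin r, (fun l : Fin r => Function.update (fun _ : Fin (r + k) => x)
          (Fin.castAdd k j) y (Fin.castAdd k l)) = Function.update (fun _ => x) j y := by
        intro j; ext l
        simp [Function.update_apply]
      have e' : ∀ j : Fin r, (fun l : Fin k => Function.update (fun _ : Fin (r + k) => x)
          (Fin.castAdd k j) y (Fin.natAdd r l)) = fun _ => x := by
        intro j; ext l
        rw [Function.update_of_ne]
        intro hh
        have := congrArg Fin.val hh
        simp at this
        omega
      simp only [e, e', insertNth_const]
      rw [polyDiff, MultilinearMap.map_update_sum]
    · unfold polyDiff₂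
      refine Finset.sum_congr rfl fun i _ => ?_
      rw [Fin.sum_univ_succAbove _ i, if_pos rfl, zero_add]
      refine Finset.sum_congr rfl fun j _ => ?_
      rw [if_neg (Fin.succAbove_ne i j), hξ]
      have e : (fun l : Fin r => Function.update (fun _ : Fin (r + k) => x)
          (Fin.natAdd r j) y (Fin.castAdd k l)) = fun _ => x := by
        ext l
        rw [Function.update_of_ne]
        intro hh
        have := congrArg Fin.val hh
        simp at this
        omega
      have e' : (fun l : Fin k => Function.update (fun _ : Fin (r + k) => x)
          (Fin.natAdd r j) y (Fin.natAdd r l)) = Function.update (fun _ => x) j y := by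
        ext l
        simp [Function.update_apply]
      rw [e, e']
      congr 1
      ext l
      cases l using Fin.succAboveCases i <;>
        simp [Function.update_apply, (Fin.succAbove_ne i _).symm]

theorem polyDiff_deriv [CharZero K] (ξ : S K X) (f : FormalSeries K X F) (q : ℕ) (x y : X) :
    polyDiff (ξ.deriv f q) x y =
      ∑ p ∈ Finset.HasAntidiagonal.antidiagonal (q + 1), (polyDiff (f p.2) x (polyDiff (ξ p.1) x y) +
        polyDiff₂ (f p.2) x ((ξ p.1 : X → X) x) y) := by
  rw [← Finset.sum_attach (Finset.HasAntidiagonal.antidiagonal (q + 1)), FormalSeries.deriv, polyDiff_sum]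
  exact Finset.sum_congr rfl fun p _ => polyDiff_polyDeriv _ _ _ _ _

theorem sum_antidiagonal_right (s : ℕ) (G : ℕ → ℕ → ℕ → F) (hG : ∀ p, G p 0 0 = 0) :
    ∑ a ∈ Finset.HasAntidiagonal.antidiagonal (s + 1), ∑ b ∈ Finset.HasAntidiagonal.antidiagonal (a.2 + 1), G a.1 b.1 b.2 =
      ∑ a ∈ Finset.HasAntidiagonal.antidiagonal (s + 2), ∑ b ∈ Finset.HasAntidiagonal.antidiagonal a.2, G a.1 b.1 b.2 := by
  rw [Finset.Nat.antidiagonal_succ' (n := s + 1)]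
  simp [hG]

theorem sum_antidiagonal_left (s : ℕ) (G : ℕ → ℕ → ℕ → F) (hG : ∀ m, G 0 0 m = 0) :
    ∑ a ∈ Finset.HasAntidiagonal.antidiagonal (s + 1), ∑ b ∈ Finset.HasAntidiagonal.antidiagonal (a.1 + 1), G b.1 b.2 a.2 =
      ∑ a ∈ Finset.HasAntidiagonal.antidiagonal (s + 2), ∑ b ∈ Finset.HasAntidiagonal.antidiagonal a.1, G b.1 b.2 a.2 := by
  rw [Finset.Nat.antidiagonal_succ (n := s + 1)]
  simp [hG]

theorem sum_antidiagonal_assoc (n : ℕ) (G : ℕ → ℕ → ℕ → F) :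
    ∑ a ∈ Finset.HasAntidiagonal.antidiagonal n, ∑ b ∈ Finset.HasAntidiagonal.antidiagonal a.1, G b.1 b.2 a.2 =
      ∑ a ∈ Finset.HasAntidiagonal.antidiagonal n, ∑ b ∈ Finset.HasAntidiagonal.antidiagonal a.2, G a.1 b.1 b.2 := by
  rw [Finset.sum_sigma', Finset.sum_sigma']
  refine Finset.sum_nbij' (fun t => ⟨(t.2.1, t.2.2 + t.1.2), (t.2.2, t.1.2)⟩)
    (fun t => ⟨(t.1.1 + t.2.1, t.2.2), (t.1.1, t.2.1)⟩) ?_ ?_ ?_ ?_ ?_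
  all_goals
    rintro ⟨⟨a, b⟩, ⟨c, d⟩⟩ h
    simp only [Finset.mem_sigma, Finset.HasAntidiagonal.mem_antidiagonal] at h ⊢
    try grind

theorem sum_antidiagonal_swap (n : ℕ) (G : ℕ → ℕ → ℕ → F) :
    ∑ a ∈ Finset.HasAntidiagonal.antidiagonal n, ∑ b ∈ Finset.HasAntidiagonal.antidiagonal a.2, G a.1 b.1 b.2 =
      ∑ a ∈ Finset.HasAntidiagonal.antidiagonal n, ∑ b ∈ Finset.HasAntidiagonal.antidiagonal a.2, G b.1 a.1 b.2 := by
  rw [← sum_antidiagonal_assoc, ← sum_antidiagonal_assoc n fun p r m => G r p m]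
  refine Finset.sum_congr rfl fun a _ => ?_
  rw [← Finset.Nat.sum_antidiagonal_swap]
  rfl

theorem deriv_deriv_sub [CharZero K] (ξ η : S K X) (f : FormalSeries K X F) (s : ℕ) (x : X) :
    (ξ.deriv (η.deriv f) s : X → F) x - ((ξ.deriv η).deriv f s : X → F) x =
      ∑ a ∈ Finset.HasAntidiagonal.antidiagonal (s + 2), ∑ b ∈ Finset.HasAntidiagonal.antidiagonal a.2,
        polyDiff₂ (f b.2) x ((η b.1 : X → X) x) ((ξ a.1 : X → X) x) := by
  simp only [deriv_apply, polyDiff_deriv, Finset.sum_add_distrib, polyDiff_map_sum]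
  rw [sum_antidiagonal_right s (fun p r m =>
      polyDiff (f m) x (polyDiff (η r) x ((ξ p : X → X) x)))
      (fun p => polyDiff_degree_zero _ _ _),
    sum_antidiagonal_right s (fun p r m =>
      polyDiff₂ (f m) x ((η r : X → X) x) ((ξ p : X → X) x))
      (fun p => by simp [polyDiff₂]),
    sum_antidiagonal_left s (fun p r m =>
      polyDiff (f m) x (polyDiff (η r) x ((ξ p : X → X) x)))
      (fun m => by
        simp only [polyDiff_degree_zero]
        simpa using polyDiff_map_smul (f m) x 0 (0 : K)),
    sum_antidiagonal_assoc (s + 2) (fun p r m =>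
      polyDiff (f m) x (polyDiff (η r) x ((ξ p : X → X) x)))]
  abel

theorem deriv_assoc_symm [CharZero K] (ξ η : S K X) (f : FormalSeries K X F) :
    ξ.deriv (η.deriv f) - (ξ.deriv η).deriv f = η.deriv (ξ.deriv f) - (η.deriv ξ).deriv f := by
  ext s x
  rw [coe_sub_apply, coe_sub_apply, deriv_deriv_sub, deriv_deriv_sub,
    sum_antidiagonal_swap (s + 2) fun p r m =>
      polyDiff₂ (f m) x ((η r : X → X) x) ((ξ p : X → X) x)]
  exact Finset.sum_congr rfl fun a _ => Finset.sum_congr rfl fun b _ => polyDiff₂_comm _ _ _ _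

/-- The bracket `[ξ, η] = ξ η - η ξ` of `S(X)`. -/
instance : Bracket (S K X) (S K X) := ⟨fun ξ η => ξ.deriv η - η.deriv ξ⟩

theorem bracket_def (ξ η : S K X) : ⁅ξ, η⁆ = ξ.deriv η - η.deriv ξ := rfl

theorem sub_deriv (ξ η : S K X) (f : FormalSeries K X F) :
    (ξ - η).deriv f = ξ.deriv f - η.deriv f := by
  rw [eq_sub_iff_add_eq, ← add_deriv, sub_add_cancel]

theorem deriv_sub [CharZero K] (ξ : S K X) (f g : FormalSeries K X F) :
    ξ.deriv (f - g) = ξ.deriv f - ξ.deriv g := by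
  rw [eq_sub_iff_add_eq, ← deriv_add, sub_add_cancel]

instance [CharZero K] : LieRing (S K X) where
  add_lie ξ η ζ := by
    simp only [bracket_def, add_deriv, deriv_add]; abel
  lie_add ξ η ζ := by
    simp only [bracket_def, add_deriv, deriv_add]; abel
  lie_self ξ := sub_self _
  leibniz_lie ξ η ζ := by
    have h1 := deriv_assoc_symm ξ η ζ
    have h2 := deriv_assoc_symm η ζ ξ
    have h3 := deriv_assoc_symm ζ ξ η
    simp only [bracket_def, sub_deriv, deriv_sub]
    rw [← sub_eq_zero] at h1 h2 h3 ⊢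
    have := congrArg₂ (· + ·) (congrArg₂ (· + ·) h1 h2) h3
    simp only [add_zero] at this
    rw [← this]
    abel

instance [CharZero K] : LieAlgebra K (S K X) where
  lie_smul c ξ η := by
    simp only [bracket_def, smul_deriv, deriv_smul, smul_sub]

variable (K X) in
/-- A formal action of a Lie algebra `A` over a vector space `X`: a Lie algebra homomorphism
`A → S(X)`. -/
abbrev FormalAction [CharZero K] (A : Type*) [LieRing A] [LieAlgebra K A] : Type _ :=
  A →ₗ⁅K⁆ S K X

end Algebraic

section Analytic

/-- A Lie ring with a norm on its underlying additive group. -/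
class NormedLieRing (A : Type*) extends LieRing A, NormedAddCommGroup A

/-- A normable Lie algebra `A` over `K`: a Lie algebra with a norm for which the bracket is
continuous. Everything below depends only on the topology which the norm defines. -/
class NormableLieAlgebra (K A : Type*) [RCLike K] [NormedLieRing A] extends
    LieAlgebra K A, NormedSpace K A where
  continuous_bracket : Continuous fun p : A × A => ⁅p.1, p.2⁆

variable {K A X F : Type*} [RCLike K] [NormedLieRing A] [NormableLieAlgebra K A]
  [NormedAddCommGroup X] [NormedSpace K X] [NormedAddCommGroup F] [NormedSpace K F]

variable (K) in
/-- An analytic law of right infinitesimal operation `a ↦ D_a` of `A` in the open subset `U` of `X`.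
Vector fields on `U` are identified with maps into `X`; the values outside of `U` are irrelevant.
The map `(a, x) ↦ D_a x` is an analytic morphism from the trivial vector bundle `A × U` into the
tangent bundle `U × X` of `U`, and `[D_a, D_b] = D_[a, b]` for the bracket of vector fields. -/
structure IsAnalyticRightInfinitesimalOperation (U : Set X) (D : A → X → X) : Prop where
  exists_bundle_morphism : ∃ Φ : X → A →L[K] X,
    AnalyticOnNhd K Φ U ∧ ∀ x ∈ U, ∀ a, D a x = Φ x a
  lieBracket_eq : ∀ a b, ∀ x ∈ U, VectorField.lieBracket K (D a) (D b) x = D ⁅a, b⁆ x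

variable (K) in
/-- The derivative `V(f) : x ↦ df_x (V x)` of a map `f` along a vector field `V`. -/
def derivAlong (V : X → X) (f : X → F) : X → F := fun x => fderiv K f x (V x)

/-- The formal series `s` is the power series of `f` at `0`: `f` is the sum near `0` of a convergent
series of continuous homogeneous polynomials, which are the components of `s`. -/
def IsPowerSeriesAtZero (f : X → F) (s : FormalSeries K X F) : Prop :=
  ∃ p : FormalMultilinearSeries K X F, HasFPowerSeriesAt f p 0 ∧
    ∀ (m : ℕ) (x : X), (s m : X → F) x = p m fun _ => x

end Analytic

end FormalLie

end

namespace FormalLie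

open Filter Topology Finset

/-! ### Uniqueness of homogeneous expansions, and Cauchy products. -/

section Summation

variable {K E F G : Type*} [RCLike K] [NormedAddCommGroup E] [NormedSpace K E]
  [NormedAddCommGroup F] [NormedSpace K F] [NormedAddCommGroup G] [NormedSpace K G]

/-! Since `dh_x` is the identity, `D_a(h)` is `D_a` itself, and `δ_a` has to be its Taylor series at
`0`. That `δ` is a Lie homomorphism comes from two facts.

Uniqueness (`IsPowerSeriesAtZero.unique`): functions that agree near `0` have the same series. On a
line `t ↦ t • x` a series of homogeneous terms becomes a power series in `t`, whose coefficients are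
determined. Every identity between the `δ_a` thus follows from one between vector fields near `0`.

Compatibility (`IsPowerSeriesAtZero.derivAlong`): if `ξ` expands `V` and `s` expands `f`, then `ξ s`
expands `V(f)`. Differentiating a series termwise gives the polarized sums `polyDiff`
(`derivSeries_apply_const`), and evaluating `df` on `V` is a Cauchy product.

Linearity of `δ` then comes from that of `Φ(x)`. Both brackets have the form `VW - WV`, so `[D_a,
D_b] = D_[a, b]` passes to the series. -/

/-- A convergent power series in one variable determines its coefficients. -/
theorem coeff_unique_of_hasSum {a b : ℕ → F} {f : K → F}
    (ha : ∀ᶠ t in 𝓝 (0 : K), HasSum (fun n => t ^ n • a n) (f t))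
    (hb : ∀ᶠ t in 𝓝 (0 : K), HasSum (fun n => t ^ n • b n) (f t)) : a = b := by
  have key : ∀ c : ℕ → F, (∀ᶠ t in 𝓝 (0 : K), HasSum (fun n => t ^ n • c n) (f t)) →
      HasFPowerSeriesAt f
        (fun n => ContinuousMultilinearMap.mkPiRing K (Fin n) (c n) :
          FormalMultilinearSeries K K F) 0 := by
    intro c hc
    refine hasFPowerSeriesAt_iff.2 ?_
    filter_upwards [hc] with t ht
    simpa [FormalMultilinearSeries.coeff] using ht
  have h := (key a ha).eq_formalMultilinearSeries (key b hb)
  funext n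
  have := congrArg (fun p : FormalMultilinearSeries K K F => p.coeff n) h
  simpa [FormalMultilinearSeries.coeff] using this

/-- A function is near `0` the sum of at most one series of homogeneous functions. -/
theorem homogeneous_unique_of_hasSum {c d : ℕ → E → F} {f : E → F}
    (hc : ∀ n (t : K) x, c n (t • x) = t ^ n • c n x)
    (hd : ∀ n (t : K) x, d n (t • x) = t ^ n • d n x)
    (hcf : ∀ᶠ x in 𝓝 (0 : E), HasSum (fun n => c n x) (f x))
    (hdf : ∀ᶠ x in 𝓝 (0 : E), HasSum (fun n => d n x) (f x)) (n : ℕ) (x : E) :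
    c n x = d n x := by
  -- Convergence is known only near `0`, but `t • x` is near `0` for small `t`, so the terms are
  -- compared at every `x`.
  have hline : Tendsto (fun t : K => t • x) (𝓝 0) (𝓝 0) := by
    have : Continuous fun t : K => t • x := by fun_prop
    simpa using this.tendsto 0
  refine congrFun (coeff_unique_of_hasSum (K := K) (a := fun n => c n x) (b := fun n => d n x)
    (f := fun t => f (t • x)) ?_ ?_) n
  · filter_upwards [hline.eventually hcf] with t ht
    simpa only [hc] using ht
  · filter_upwards [hline.eventually hdf] with t ht
    simpa only [hd] using ht

/-- The Cauchy product of two absolutely convergent series for the application of linear maps. -/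
theorem hasSum_clm_apply_antidiagonal [CompleteSpace G] {g : ℕ → F →L[K] G} {v : ℕ → F}
    {g₀ : F →L[K] G} {v₀ : F} (hg : HasSum g g₀) (hv : HasSum v v₀)
    (hg' : Summable fun n => ‖g n‖) (hv' : Summable fun n => ‖v n‖) :
    HasSum (fun n => ∑ p ∈ antidiagonal n, g p.1 (v p.2)) (g₀ v₀) := by
  -- The bound `‖g k‖ * ‖v l‖` makes the double family absolutely summable, so it may be summed by
  -- rows, to identify its sum, and then by antidiagonals.
  have hs : Summable fun p : ℕ × ℕ => g p.1 (v p.2) := by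
    refine Summable.of_norm_bounded
      (hg'.mul_of_nonneg hv' (fun _ => norm_nonneg _) fun _ => norm_nonneg _) fun p => ?_
    exact (g p.1).le_opNorm _
  have h1 : HasSum (fun p : ℕ × ℕ => g p.1 (v p.2)) (g₀ v₀) := by
    have h2 : HasSum (fun k => g k v₀) (∑' p : ℕ × ℕ, g p.1 (v p.2)) :=
      hs.hasSum.prod_fiberwise fun k => (g k).hasSum hv
    have h3 : HasSum (fun k => g k v₀) (g₀ v₀) :=
      (ContinuousLinearMap.apply K G v₀).hasSum hg
    have h4 : g₀ v₀ = ∑' p : ℕ × ℕ, g p.1 (v p.2) := HasSum.unique h3 h2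
    rw [h4]
    exact hs.hasSum
  refine ((HasAntidiagonal.sigmaAntidiagonalEquivProd (A := ℕ)).hasSum_iff.2 h1).sigma fun n => ?_
  have := hasSum_fintype fun p : antidiagonal n => g p.1.1 (v p.1.2)
  rwa [Finset.univ_eq_attach, sum_attach (antidiagonal n) fun p => g p.1 (v p.2)] at this

theorem analyticAt_clm_apply {g : E → F →L[K] G} {v : E → F} {x : E} (hg : AnalyticAt K g x)
    (hv : AnalyticAt K v x) : AnalyticAt K (fun y => g y (v y)) x :=
  ((ContinuousLinearMap.id K (F →L[K] G)).analyticAt_bilinear (g x, v x)).comp₂ hg hv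

end Summation

/-! ### Formal series that represent analytic functions. -/

section PowerSeries

variable {K X F : Type*} [RCLike K] [NormedAddCommGroup X] [NormedSpace K X]
  [NormedAddCommGroup F] [NormedSpace K F]

/-- The formal series whose components are the homogeneous polynomials determined by the terms of
a formal multilinear series. -/
noncomputable def FormalSeries.ofMultilinear (p : FormalMultilinearSeries K X F) :
    FormalSeries K X F :=
  fun m => ⟨fun x => p m fun _ => x, (p m).toMultilinearMap, fun _ => rfl⟩

theorem homogPoly_map_smul {m : ℕ} (f : homogPoly K X F m) (t : K) (x : X) :
    (f : X → F) (t • x) = t ^ m • (f : X → F) x := by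
  obtain ⟨u, hu⟩ := f.2
  rw [hu, hu]
  simpa using u.map_smul_univ (fun _ => t) fun _ => x

theorem hasSum_of_hasFPowerSeriesAt {f : X → F} {p : FormalMultilinearSeries K X F}
    (h : HasFPowerSeriesAt f p 0) : ∀ᶠ x in 𝓝 (0 : X), HasSum (fun m => p m fun _ => x) (f x) := by
  simpa using h.eventually_hasSum

/-- A formal series is the power series of an analytic function if and only if it converges
to it. -/
theorem isPowerSeriesAtZero_iff {f : X → F} {s : FormalSeries K X F} :
    IsPowerSeriesAtZero f s ↔
      AnalyticAt K f 0 ∧ ∀ᶠ x in 𝓝 (0 : X), HasSum (fun m => (s m : X → F) x) (f x) := by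
  constructor
  · rintro ⟨p, hp, hs⟩
    refine ⟨hp.analyticAt, ?_⟩
    simpa only [hs] using hasSum_of_hasFPowerSeriesAt hp
  · rintro ⟨⟨p, hp⟩, hs⟩
    -- The terms of `s` are not assumed continuous: uniqueness identifies them with those of the
    -- continuous expansion `p`.
    exact ⟨p, hp, homogeneous_unique_of_hasSum (fun m => homogPoly_map_smul (s m))
      (fun m => homogPoly_map_smul (FormalSeries.ofMultilinear p m)) hs
      (hasSum_of_hasFPowerSeriesAt hp)⟩

theorem exists_isPowerSeriesAtZero {f : X → F} (hf : AnalyticAt K f 0) :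
    ∃ s : FormalSeries K X F, IsPowerSeriesAtZero f s :=
  let ⟨p, hp⟩ := hf
  ⟨FormalSeries.ofMultilinear p, p, hp, fun _ _ => rfl⟩

theorem IsPowerSeriesAtZero.unique {f g : X → F} {s t : FormalSeries K X F}
    (hs : IsPowerSeriesAtZero f s) (ht : IsPowerSeriesAtZero g t) (hfg : f =ᶠ[𝓝 0] g) :
    s = t := by
  rw [isPowerSeriesAtZero_iff] at hs ht
  refine FormalSeries.ext (homogeneous_unique_of_hasSum (fun m => homogPoly_map_smul (s m))
      (fun m => homogPoly_map_smul (t m)) hs.2 ?_)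
  filter_upwards [ht.2, hfg] with x hx hx'
  rwa [hx']

theorem IsPowerSeriesAtZero.add {f g : X → F} {s t : FormalSeries K X F}
    (hs : IsPowerSeriesAtZero f s) (ht : IsPowerSeriesAtZero g t) :
    IsPowerSeriesAtZero (f + g) (s + t) := by
  rw [isPowerSeriesAtZero_iff] at hs ht ⊢
  refine ⟨hs.1.add ht.1, ?_⟩
  filter_upwards [hs.2, ht.2] with x hx hx'
  exact hx.add hx'

theorem IsPowerSeriesAtZero.sub {f g : X → F} {s t : FormalSeries K X F}
    (hs : IsPowerSeriesAtZero f s) (ht : IsPowerSeriesAtZero g t) :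
    IsPowerSeriesAtZero (f - g) (s - t) := by
  rw [isPowerSeriesAtZero_iff] at hs ht ⊢
  refine ⟨hs.1.sub ht.1, ?_⟩
  filter_upwards [hs.2, ht.2] with x hx hx'
  exact hx.sub hx'

theorem IsPowerSeriesAtZero.const_smul {f : X → F} {s : FormalSeries K X F}
    (hs : IsPowerSeriesAtZero f s) (c : K) : IsPowerSeriesAtZero (c • f) (c • s) := by
  rw [isPowerSeriesAtZero_iff] at hs ⊢
  refine ⟨hs.1.const_smul, ?_⟩
  filter_upwards [hs.2] with x hx
  exact hx.const_smul c

/-- The terms of the power series of the derivative are the differentials of the terms of the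
power series. -/
theorem derivSeries_apply_const (p : FormalMultilinearSeries K X F) (k : ℕ)
    (f : homogPoly K X F (k + 1)) (hf : ∀ x, (f : X → F) x = p (k + 1) fun _ => x) (x y : X) :
    p.derivSeries k (fun _ => x) y = polyDiff f x y := by
  classical
  -- `derivSeries k` is built from `p (1 + k)`, whereas `f` has degree `k + 1`; the degree is left
  -- variable so that this equality can be substituted.
  have hcast : ∀ m (h : m = k + 1), polyDiff f x y =
      ∑ i : Fin m, p m (Function.update (fun _ => x) i y) := by
    rintro _ rfl
    exact polyDiff_eq f (p (k + 1)).toMultilinearMap hf x y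
  rw [hcast (1 + k) (add_comm 1 k)]
  -- The linear part in `y` of `p (1 + k)` at `x + y`: the `k` places in `s` receive `x`, the
  -- remaining one receives `y`.
  have h1 : p.derivSeries k (fun _ => x) y =
      ∑ s : {s : Finset (Fin (1 + k)) // s.card = k},
        p (1 + k) (s.1.piecewise (fun _ => x) fun _ => y) := by
    simp only [FormalMultilinearSeries.derivSeries,
      ContinuousLinearMap.compFormalMultilinearSeries_apply,
      FormalMultilinearSeries.changeOriginSeries,
      ContinuousLinearMap.compContinuousMultilinearMap_coe, ContinuousLinearEquiv.coe_coe,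
      LinearIsometryEquiv.coe_coe, Function.comp_apply, _root_.sum_apply,
      map_sum, continuousMultilinearCurryFin1_apply, Matrix.zero_empty]
    refine Finset.sum_congr rfl fun s _ => ?_
    rw [← p.changeOriginSeriesTerm_apply 1 k s.1 s.2]
    congr 1
  rw [h1]
  symm
  -- A `k`-element subset of `Fin (1 + k)` is the complement of one place, the one that holds `y`.
  refine Finset.sum_bij (fun i _ => ⟨{i}ᶜ, by simp [card_compl]⟩) (by simp) ?_ ?_ ?_
  · intro i _ j _ h
    simpa using h
  · rintro ⟨s, hs⟩ _
    have : sᶜ.card = 1 := by rw [card_compl, hs, Fintype.card_fin]; omega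
    obtain ⟨i, hi⟩ := card_eq_one.1 this
    exact ⟨i, mem_univ _, Subtype.ext (by simp [← hi])⟩
  · intro i _
    congr 1
    ext j
    by_cases h : j = i
    · subst h; simp
    · simp [Finset.piecewise, h]

/-- The derivative of a formal series relative to another represents the derivative of a function
along a vector field. -/
theorem IsPowerSeriesAtZero.derivAlong [CompleteSpace F] {V : X → X} {f : X → F} {ξ : S K X}
    {s : FormalSeries K X F} (hV : IsPowerSeriesAtZero V ξ) (hf : IsPowerSeriesAtZero f s) :
    IsPowerSeriesAtZero (derivAlong K V f) (ξ.deriv s) := by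
  obtain ⟨p, ⟨r, hp⟩, hs⟩ := hf
  obtain ⟨q, ⟨r', hq⟩, hξ⟩ := hV
  rw [isPowerSeriesAtZero_iff]
  refine ⟨analyticAt_clm_apply hp.analyticAt.fderiv hq.analyticAt, ?_⟩
  filter_upwards [Metric.eball_mem_nhds (0 : X) hp.r_pos,
    Metric.eball_mem_nhds (0 : X) hq.r_pos] with x hx hx'
  have hg := hp.fderiv.hasSum hx
  have hv := hq.hasSum hx'
  rw [zero_add] at hg hv
  have h := hasSum_clm_apply_antidiagonal hg hv
    (p.derivSeries.summable_norm_apply (Metric.eball_subset_eball hp.fderiv.r_le hx))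
    (q.summable_norm_apply (Metric.eball_subset_eball hq.r_le hx'))
  suffices hterm : (fun n => (ξ.deriv s n : X → F) x) =
      fun n => ∑ a ∈ antidiagonal n, p.derivSeries a.1 (fun _ => x) (q a.2 fun _ => x) by
    rw [hterm]
    exact h
  funext n
  -- In `ξ s` the degrees satisfy `r + m = n + 1`. The term `m = 0` vanishes, and `m = k + 1` leaves
  -- `k + r = n`, as in the Cauchy product; the swap puts `m` first so that it can be split off.
  rw [deriv_apply, ← Finset.Nat.sum_antidiagonal_swap, Finset.Nat.antidiagonal_succ]
  simp only [Prod.fst_swap, Prod.snd_swap, sum_cons, sum_map, polyDiff_degree_zero, zero_add]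
  refine Finset.sum_congr rfl fun a _ => ?_
  rw [derivSeries_apply_const p a.1 (s (a.1 + 1)) (hs _), ← hξ]
  rfl

end PowerSeries

theorem derivAlong_id {K X : Type*} [RCLike K] [NormedAddCommGroup X] [NormedSpace K X]
    (V : X → X) : derivAlong K V (fun x => x) = V := by
  funext x
  simp [derivAlong]

/-! ### From infinitesimal operations to formal actions. -/

namespace IsAnalyticRightInfinitesimalOperation

variable {K A X : Type*} [RCLike K] [NormedLieRing A] [NormableLieAlgebra K A]
  [NormedAddCommGroup X] [NormedSpace K X] {U : Set X} {D : A → X → X}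

theorem analyticOnNhd (hD : IsAnalyticRightInfinitesimalOperation K U D) (hU : IsOpen U) (a : A) :
    AnalyticOnNhd K (D a) U := by
  obtain ⟨Φ, hΦ, hΦD⟩ := hD.exists_bundle_morphism
  refine AnalyticOnNhd.congr hU (fun x hx => analyticAt_clm_apply (hΦ x hx) analyticAt_const)
    fun x hx => (hΦD x hx a).symm

/-- The power series of the vector fields of an analytic law of infinitesimal operation form a
formal action. -/
theorem exists_formalAction [CompleteSpace X] (hD : IsAnalyticRightInfinitesimalOperation K U D)
    (hU : IsOpen U) (h0 : (0 : X) ∈ U) :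
    ∃ δ : FormalAction K X A, ∀ a, IsPowerSeriesAtZero (D a) (δ a) := by
  have hU0 : U ∈ 𝓝 (0 : X) := hU.mem_nhds h0
  -- The series are chosen separately for each `a`; uniqueness makes the choices compatible with
  -- sums, scalars and brackets.
  choose δ hδ using fun a => exists_isPowerSeriesAtZero (hD.analyticOnNhd hU a 0 h0)
  obtain ⟨Φ, -, hΦD⟩ := hD.exists_bundle_morphism
  refine ⟨{ toFun := δ, map_add' := fun a b => ?_, map_smul' := fun c a => ?_,
            map_lie' := fun {a b} => ?_ }, hδ⟩
  · refine (hδ (a + b)).unique ((hδ a).add (hδ b)) ?_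
    filter_upwards [hU0] with x hx
    simp [hΦD x hx]
  · refine (hδ (c • a)).unique ((hδ a).const_smul c) ?_
    filter_upwards [hU0] with x hx
    simp [hΦD x hx]
  · refine (hδ ⁅a, b⁆).unique
      (((hδ a).derivAlong (hδ b)).sub ((hδ b).derivAlong (hδ a))) ?_
    filter_upwards [hU0] with x hx
    -- By definition `VectorField.lieBracket` is the difference of the two `derivAlong` terms, with
    -- the sign convention of the bracket of `S(X)`.
    exact (hD.lieBracket_eq a b x hx).symm

end IsAnalyticRightInfinitesimalOperation

end FormalLie

theorem mainTheorem8 {K A X : Type*} [RCLike K]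
    [FormalLie.NormedLieRing A] [FormalLie.NormableLieAlgebra K A] [CompleteSpace A]
    [NormedAddCommGroup X] [NormedSpace K X] [CompleteSpace X]
    (U : Set X) (hU : IsOpen U) (h0 : (0 : X) ∈ U) (D : A → X → X)
    (hD : FormalLie.IsAnalyticRightInfinitesimalOperation K U D) :
    (∀ a : A, AnalyticOnNhd K (FormalLie.derivAlong K (D a) (fun x : X => x)) U ∧
      ∃! s : FormalLie.S K X,
        FormalLie.IsPowerSeriesAtZero (FormalLie.derivAlong K (D a) (fun x : X => x)) s) ∧
    ∃ δ : FormalLie.FormalAction K X A, ∀ a : A,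
      FormalLie.IsPowerSeriesAtZero (FormalLie.derivAlong K (D a) (fun x : X => x)) (δ a) := by
  simp only [FormalLie.derivAlong_id]
  refine ⟨fun a => ⟨hD.analyticOnNhd hU a, ?_⟩, hD.exists_formalAction hU h0⟩
  obtain ⟨s, hs⟩ := FormalLie.exists_isPowerSeriesAtZero (hD.analyticOnNhd hU a 0 h0)
  exact ⟨s, hs, fun t ht => ht.unique hs Filter.EventuallyEq.rfl⟩
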